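/- Let $S$ be a Polish space equipped with a partial order $\preceq$ whose graph $\{(x,y) : x \preceq y\}$ is closed in $S \times S$. A set $I \subset S$ is increasing if $x \in I$ and $x \preceq y$ imply $y \in I$. For $B \subset S$ let $i(B) = \{y : x \preceq y \text{ for some } x \in B\}$ and $d(B) = \{y : y \preceq x \text{ for some } x \in B\}$. For finite Borel measures write $\mu' \leq \mu$ if $\mu'(B) \leq \mu(B)$ for all Borel sets $B$, and $\mu' \preceq_{sd} \nu'$ if $\mu'(S) = \nu'(S)$ and $\mu'(I) \leq \nu'(I)$ for every increasing Borel set $I$. The ordered affinity of finite Borel measures $\mu, \nu$ is $$\alpha_O(\mu,\nu) = \sup\{\mu'(S) : \mu', \nu' \text{ finite Borel measures},\ \mu' \leq \mu,\ \nu' \leq \nu,\ \mu' \preceq_{sd} \nu'\}.$$ Suppose that for every compact $K \subset S$ the set $i(K) \cap d(K)$ is compact. Then $$\gamma(\mu,\nu) = 2 - \alpha_O(\mu,\nu) - \alpha_O(\nu,\mu)$$ is a metric on the set $\mathscr P$ of Borel probability measures on $S$, and the metric space $(\mathscr P, \gamma)$ is complete. -/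

import Mathlib

open MeasureTheory

noncomputable section

namespace TotalOrderedVariation

variable {S : Type*} [MeasurableSpace S] [Preorder S]

/-- Stochastic dominance `μ ⪯_sd ν` of finite measures: equal total mass, and `μ I ≤ ν I` for
every increasing Borel set `I`. -/
structure StochDom (μ ν : FiniteMeasure S) : Prop where
  mass_eq : μ.mass = ν.mass
  le_of_increasing : ∀ I : Set S, MeasurableSet I → IsUpperSet I → μ I ≤ ν I

/-- The set `Φ(μ, ν)` of ordered component pairs: pairs of finite measures `(μ', ν')` with
`μ' ≤ μ` and `ν' ≤ ν` setwise and `μ' ⪯_sd ν'`. -/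
def orderedComponentPairs (μ ν : FiniteMeasure S) : Set (FiniteMeasure S × FiniteMeasure S) :=
  {p | (p.1 : Measure S) ≤ (μ : Measure S) ∧ (p.2 : Measure S) ≤ (ν : Measure S) ∧
    StochDom p.1 p.2}

/-- The ordered affinity `α_O(μ, ν)`: the supremum of the masses of the ordered component
pairs. -/
def orderedAffinity (μ ν : FiniteMeasure S) : ℝ :=
  sSup ((fun p : FiniteMeasure S × FiniteMeasure S => (p.1.mass : ℝ)) ''
    orderedComponentPairs μ ν)

/-- The set of masses defining `orderedAffinity` is nonempty. -/
theorem masses_nonempty (μ ν : FiniteMeasure S) :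
    ((fun p : FiniteMeasure S × FiniteMeasure S => (p.1.mass : ℝ)) ''
      orderedComponentPairs μ ν).Nonempty := by
  refine ⟨_, (0, 0), ⟨?_, ?_, rfl, fun _ _ _ => le_rfl⟩, rfl⟩
  · exact Measure.zero_le _
  · exact Measure.zero_le _

/-- The set of masses defining `orderedAffinity` is bounded above by the mass of `μ`. -/
theorem masses_bddAbove (μ ν : FiniteMeasure S) :
    BddAbove ((fun p : FiniteMeasure S × FiniteMeasure S => (p.1.mass : ℝ)) ''
      orderedComponentPairs μ ν) := by
  refine ⟨(μ.mass : ℝ), ?_⟩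
  rintro _ ⟨p, ⟨h, -, -⟩, rfl⟩
  exact NNReal.coe_le_coe.2 (ENNReal.toNNReal_mono (measure_ne_top _ _) (h Set.univ))

/-- The total ordered variation distance `γ(μ, ν) = 2 - α_O(μ, ν) - α_O(ν, μ)` between
probability measures. -/
def gamma (μ ν : ProbabilityMeasure S) : ℝ :=
  2 - orderedAffinity μ.toFiniteMeasure ν.toFiniteMeasure
    - orderedAffinity ν.toFiniteMeasure μ.toFiniteMeasure

end TotalOrderedVariation

end

/-! Everything rests on the duality `orderedAffinity_eq`: α_O(μ,ν) = 1 - sup_I (μ I - ν I), over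
Borel upper sets I. By `gamma_eq`, γ is then the sum of the two one-sided sup distances over upper
sets, so symmetry and the triangle inequality are immediate.

The hard half of the duality is an infinite linear program. Its feasible set is relaxed to finitely
additive set functions below μ and ν, a Tychonoff-compact convex set; Hahn-Banach reduces
solvability to single weighted inequalities, and domination by μ and ν restores countable
additivity.

Definiteness: the closed order yields countably many Borel upper sets that separate points (an
ordered Lusin separation), and these generate the Borel σ-algebra (`ext_of_isUpperSet`).

Completeness: γ controls upper and lower sets uniformly, hence i(Q) ∩ d(Q) for compact Q, and the
hypothesis on S makes γ-Cauchy sequences tight. Prokhorov gives a weak subsequential limit; inner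
approximation by closed upper or lower sets and the portmanteau theorem turn weak convergence into
γ-convergence. -/

noncomputable section

open Filter Topology Set

namespace TotalOrderedVariation

/-! ### Linear inequalities on compact convex sets -/

/-- A system of weak linear inequalities has a solution in a compact convex set as soon as every
nonnegative finite combination of the inequalities has one. -/
theorem exists_forall_le_of_forall_weights {E ι : Type*} [AddCommGroup E] [Module ℝ E]
    [TopologicalSpace E] {K : Set E} (hK : IsCompact K) (hconv : Convex ℝ K)
    (L : ι → E →L[ℝ] ℝ) (b : ι → ℝ)
    (h : ∀ (s : Finset ι) (w : ι → ℝ), (∀ i, 0 ≤ w i) →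
      ∃ x ∈ K, ∑ i ∈ s, w i * b i ≤ ∑ i ∈ s, w i * L i x) :
    ∃ x ∈ K, ∀ i, b i ≤ L i x := by
  classical
  have key : ∀ s : Finset ι, (K ∩ ⋂ i ∈ s, {x | b i ≤ L i x}).Nonempty := by
    intro s
    let T : E →L[ℝ] (s → ℝ) := ContinuousLinearMap.pi fun i => L i
    let P : Set (s → ℝ) := Set.Ici fun i => b i
    by_contra hne
    have hdisj : Disjoint (T '' K) P := by
      rw [Set.disjoint_left]
      rintro _ ⟨x, hx, rfl⟩ hP
      refine hne ⟨x, hx, ?_⟩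
      simp only [mem_iInter, mem_ofPred_eq]
      intro i hi
      exact hP ⟨i, hi⟩
    obtain ⟨f, u, v, hu, huv, hv⟩ := geometric_hahn_banach_compact_closed
      (hconv.linear_image T.toLinearMap) (hK.image T.continuous) (convex_Ici _) isClosed_Ici hdisj
    have hf : ∀ y : s → ℝ, f y = ∑ i, y i * f (Pi.single i 1) := by
      intro y
      have := LinearMap.pi_apply_eq_sum_univ f.toLinearMap y
      simp only [ContinuousLinearMap.coe_coe, smul_eq_mul] at this
      rw [this]
      refine Finset.sum_congr rfl fun i _ => ?_
      congr 2
      ext j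
      simp [Pi.single_apply, eq_comm]
    -- The orthant `P` is stable under adding multiples of basis vectors; a negative coefficient
    -- would drive `f` below `v` on `P`.
    have hnonneg : ∀ i, 0 ≤ f (Pi.single i 1) := by
      intro i
      by_contra! hi
      obtain ⟨t, ht0, ht⟩ : ∃ t : ℝ, 0 ≤ t ∧ f (fun i : s => b i) + t * f (Pi.single i 1) ≤ v := by
        refine ⟨max 0 ((v - f fun i : s => b i) / f (Pi.single i 1)), le_max_left _ _, ?_⟩
        have := mul_le_mul_of_nonpos_right
          (le_max_right 0 ((v - f fun i : s => b i) / f (Pi.single i 1))) hi.le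
        rw [div_mul_cancel₀ _ hi.ne] at this
        linarith
      have hmem : (fun i : s => b i) + t • Pi.single i (1 : ℝ) ∈ P := by
        refine le_add_of_nonneg_right (smul_nonneg (β := s → ℝ) ht0 ?_)
        exact Pi.single_nonneg.2 zero_le_one
      have := hv _ hmem
      rw [map_add, map_smul, smul_eq_mul] at this
      linarith
    let w : ι → ℝ := fun i => if hi : i ∈ s then f (Pi.single ⟨i, hi⟩ 1) else 0
    have hw : ∀ i : s, w i = f (Pi.single i 1) := fun i => by simp [w]
    obtain ⟨x, hxK, hx⟩ := h s w fun i => by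
      by_cases hi : i ∈ s
      · simpa [w, hi] using hnonneg _
      · simp [w, hi]
    have h1 := hu _ (mem_image_of_mem T hxK)
    have h2 := hv _ (le_refl (fun i : s => b i))
    rw [hf] at h1 h2
    rw [← Finset.sum_coe_sort s, ← Finset.sum_coe_sort s] at hx
    simp only [hw] at hx
    have h3 : ∑ i : s, T x i * f (Pi.single i 1) = ∑ i : s, f (Pi.single i 1) * L i x :=
      Finset.sum_congr rfl fun i _ => mul_comm _ _
    have h4 : ∑ i : s, b i * f (Pi.single i 1) = ∑ i : s, f (Pi.single i 1) * b i :=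
      Finset.sum_congr rfl fun i _ => mul_comm _ _
    linarith
  obtain ⟨x, hx, hx'⟩ := hK.inter_iInter_nonempty (fun i => {x | b i ≤ L i x})
    (fun i => isClosed_le continuous_const (L i).continuous) key
  exact ⟨x, hx, fun i => mem_iInter.1 hx' i⟩

/-! ### Finitely additive set functions below a measure -/

section Dominated

variable {S : Type*} [MeasurableSpace S]

/-- The finitely additive set functions between `0` and `μ`. -/
def dominatedContents (μ : Measure S) : Set (Set S → ℝ) :=
  {m | (∀ A, m A ∈ Icc 0 (μ.real A)) ∧
    ∀ A B, MeasurableSet A → MeasurableSet B → Disjoint A B → m (A ∪ B) = m A + m B}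

/-- Tychonoff: each condition involves finitely many coordinates, so it is closed under pointwise
limits. Countable additivity would not be, hence the relaxation. Non-measurable sets are bounded
too, so that the ambient product is compact. -/
theorem isCompact_dominatedContents (μ : Measure S) : IsCompact (dominatedContents μ) := by
  have h : IsCompact (Set.pi univ fun A : Set S => Icc 0 (μ.real A)) :=
    isCompact_univ_pi fun _ => isCompact_Icc
  refine h.of_isClosed_subset ?_ fun m hm A _ => hm.1 A
  have h' : dominatedContents μ = (⋂ A, {m : Set S → ℝ | m A ∈ Icc 0 (μ.real A)}) ∩
      ⋂ (A) (B) (_ : MeasurableSet A) (_ : MeasurableSet B) (_ : Disjoint A B),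
        {m : Set S → ℝ | m (A ∪ B) = m A + m B} := by
    ext m
    simp [dominatedContents]
  rw [h']
  refine IsClosed.inter ?_ ?_
  · exact isClosed_iInter fun A => isClosed_Icc.preimage (continuous_apply A)
  · refine isClosed_iInter fun A => isClosed_iInter fun B => isClosed_iInter fun _ =>
      isClosed_iInter fun _ => isClosed_iInter fun _ => ?_
    exact isClosed_eq (by fun_prop) (by fun_prop)

theorem convex_dominatedContents (μ : Measure S) : Convex ℝ (dominatedContents μ) := by
  intro m hm n hn a b ha hb hab
  refine ⟨fun A => convex_Icc 0 (μ.real A) (hm.1 A) (hn.1 A) ha hb hab, ?_⟩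
  intro A B hA hB hAB
  simp only [Pi.add_apply, Pi.smul_apply, smul_eq_mul, hm.2 A B hA hB hAB, hn.2 A B hA hB hAB]
  ring

theorem restrict_mem_dominatedContents (μ : Measure S) [IsFiniteMeasure μ] (B : Set S) :
    (μ.restrict B).real ∈ dominatedContents μ :=
  ⟨fun A => ⟨measureReal_nonneg,
    ENNReal.toReal_mono (measure_ne_top _ _) (Measure.restrict_apply_le _ _)⟩,
    fun _ _ _ hB hAB => measureReal_union hAB hB⟩

/-- A finitely additive set function dominated by a finite measure is a measure. -/
theorem exists_measure_of_mem_dominatedContents {μ : Measure S} [IsFiniteMeasure μ]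
    {m : Set S → ℝ} (hm : m ∈ dominatedContents μ) :
    ∃ ρ : Measure S, ρ ≤ μ ∧ ∀ A, MeasurableSet A → ρ.real A = m A := by
  have h0 : ∀ A, 0 ≤ m A := fun A => (hm.1 A).1
  have hempty : m ∅ = 0 := le_antisymm (by simpa using (hm.1 ∅).2) (h0 _)
  have hsum : ∀ f : ℕ → Set S, (∀ i, MeasurableSet (f i)) → Pairwise (Function.onFun Disjoint f) →
      HasSum (fun i => m (f i)) (m (⋃ i, f i)) := by
    intro f hf hd
    have hU : ∀ n, MeasurableSet (⋃ i ∈ Finset.range n, f i) := fun n =>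
      Finset.measurableSet_biUnion _ fun i _ => hf i
    have hpart : ∀ n, m (⋃ i ∈ Finset.range n, f i) = ∑ i ∈ Finset.range n, m (f i) := by
      intro n
      induction n with
      | zero => simpa using hempty
      | succ n ih =>
        rw [Finset.sum_range_succ, ← ih, ← hm.2 _ _ (hU n) (hf n)]
        · congr 1
          rw [Finset.range_add_one, Finset.set_biUnion_insert, union_comm]
        · simp only [Set.disjoint_iUnion_left, Finset.mem_range]
          exact fun i hi => hd hi.ne
    have hμsum : HasSum (fun i => μ.real (f i)) (μ.real (⋃ i, f i)) := by
      have hne : ∑' i, μ (f i) ≠ ⊤ := by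
        rw [← measure_iUnion hd hf]
        exact measure_ne_top μ _
      rw [measureReal_def, measure_iUnion hd hf,
        ENNReal.tsum_toReal_eq fun i => measure_ne_top μ (f i)]
      exact ENNReal.hasSum_toReal hne
    rw [hasSum_iff_tendsto_nat_of_nonneg fun i => h0 _]
    have hlim := (hμsum.tendsto_sum_nat.const_sub (μ.real (⋃ i, f i)))
    rw [sub_self] at hlim
    -- The defect of countable additivity is `m` of the tail, which is at most `μ` of the tail and
    -- so tends to 0.
    have hdiff : ∀ n, 0 ≤ m (⋃ i, f i) - ∑ i ∈ Finset.range n, m (f i) ∧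
        m (⋃ i, f i) - ∑ i ∈ Finset.range n, m (f i)
          ≤ μ.real (⋃ i, f i) - ∑ i ∈ Finset.range n, μ.real (f i) := by
      intro n
      have hsub : (⋃ i ∈ Finset.range n, f i) ⊆ ⋃ i, f i :=
        iUnion₂_subset fun i _ => subset_iUnion f i
      have h1 := hm.2 (⋃ i ∈ Finset.range n, f i) ((⋃ i, f i) \ ⋃ i ∈ Finset.range n, f i) (hU n)
        ((MeasurableSet.iUnion hf).diff (hU n)) disjoint_sdiff_right
      rw [union_sdiff_cancel hsub, hpart] at h1
      have h2 := measureReal_sdiff (μ := μ) hsub (hU n)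
      rw [measureReal_biUnion_finset (fun i _ j _ hij => hd hij) fun i _ => hf i] at h2
      have h3 := hm.1 ((⋃ i, f i) \ ⋃ i ∈ Finset.range n, f i)
      rw [h2] at h3
      constructor <;> linarith [h3.1, h3.2]
    have := squeeze_zero (fun n => (hdiff n).1) (fun n => (hdiff n).2) hlim
    have := this.const_sub (m (⋃ i, f i))
    simpa using this
  let ρ : Measure S := Measure.ofMeasurable (fun A _ => ENNReal.ofReal (m A)) (by simp [hempty])
    (by
      intro f hf hd
      rw [← (hsum f hf hd).tsum_eq]
      exact ENNReal.ofReal_tsum_of_nonneg (fun i => h0 _) (hsum f hf hd).summable)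
  have hρ : ∀ A, MeasurableSet A → ρ A = ENNReal.ofReal (m A) := fun A hA =>
    Measure.ofMeasurable_apply A hA
  refine ⟨ρ, Measure.le_iff.2 fun A hA => ?_, fun A hA => ?_⟩
  · rw [hρ A hA]
    exact ENNReal.ofReal_le_of_le_toReal (hm.1 A).2
  · rw [measureReal_def, hρ A hA, ENNReal.toReal_ofReal (h0 A)]

end Dominated

/-! ### Existence of ordered component pairs by duality -/

section Duality

variable {S : Type*} [MeasurableSpace S] [Preorder S]

/-- Dominance up to a deficit on upper sets passes to integrals of bounded monotone functions. -/
theorem integral_sub_integral_le_of_monotone {μ ν : Measure S} [IsFiniteMeasure μ]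
    [IsFiniteMeasure ν] {d : ℝ}
    (h : ∀ I : Set S, MeasurableSet I → IsUpperSet I → μ.real I - ν.real I ≤ d)
    {k : S → ℝ} (hk : Measurable k) (hmono : Monotone k) {c : ℝ} (h0 : ∀ x, 0 ≤ k x)
    (hc : ∀ x, k x ≤ c) (hc0 : 0 ≤ c) :
    ∫ x, k x ∂μ - ∫ x, k x ∂ν ≤ c * d := by
  have hint : ∀ ρ : Measure S, IsFiniteMeasure ρ → Integrable k ρ := fun ρ _ =>
    Integrable.of_bound hk.aestronglyMeasurable c (ae_of_all _ fun x => by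
      rw [Real.norm_of_nonneg (h0 x)]; exact hc x)
  have hanti : ∀ ρ : Measure S, IsFiniteMeasure ρ →
      IntegrableOn (fun t => ρ.real {x | t ≤ k x}) (Ioc 0 c) := by
    intro ρ _
    refine IntegrableOn.mono_set ?_ Ioc_subset_Icc_self
    refine AntitoneOn.integrableOn_isCompact isCompact_Icc ?_
    exact fun s _ t _ hst => measureReal_mono fun x hx => le_trans hst hx
  -- Layer-cake formula; superlevel sets of a monotone function are upper sets.
  rw [(hint μ inferInstance).integral_eq_integral_Ioc_meas_le (ae_of_all _ h0) (ae_of_all _ hc),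
    (hint ν inferInstance).integral_eq_integral_Ioc_meas_le (ae_of_all _ h0) (ae_of_all _ hc),
    ← integral_sub (hanti μ inferInstance) (hanti ν inferInstance)]
  calc _ ≤ ∫ _ in Ioc 0 c, d := by
        refine integral_mono ((hanti μ inferInstance).sub (hanti ν inferInstance))
          (integrable_const _) fun t => ?_
        exact h _ (measurableSet_le measurable_const hk) fun x y hxy hx => le_trans hx (hmono hxy)
    _ = c * d := by simp [hc0]

/-- The finite-dimensional value of the duality. -/
theorem mul_le_integral_posPart_add {μ ν : Measure S} [IsFiniteMeasure μ] [IsFiniteMeasure ν]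
    {a : ℝ} (ha : 0 ≤ a)
    (h : ∀ I : Set S, MeasurableSet I → IsUpperSet I → μ.real I - ν.real I ≤ μ.real univ - a)
    {q : S → ℝ} (hq : Measurable q) (hmono : Monotone q) (hμ : Integrable q μ)
    (hν : Integrable q ν) (c : ℝ) :
    c * a ≤ ∫ x in {x | q x < c}, (c - q x) ∂μ + ∫ x in {x | 0 < q x}, q x ∂ν := by
  have hB : MeasurableSet {x | q x < c} := measurableSet_lt hq measurable_const
  have hB' : MeasurableSet {x | 0 < q x} := measurableSet_lt measurable_const hq
  rcases le_or_gt c 0 with hc | hc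
  · refine (mul_nonpos_of_nonpos_of_nonneg hc ha).trans (add_nonneg ?_ ?_)
    · exact setIntegral_nonneg hB fun x hx => sub_nonneg.2 (le_of_lt hx)
    · exact setIntegral_nonneg hB' fun x hx => le_of_lt hx
  -- Truncating `q` to `[0, c]` keeps it monotone and gives c - k ≤ (c - q)⁺ and k ≤ q⁺, so the
  -- right side is at least c μ(S) - (∫ k dμ - ∫ k dν) ≥ c a.
  · let k : S → ℝ := fun x => max 0 (min (q x) c)
    have hk : Measurable k := measurable_const.max (hq.min measurable_const)
    have hk0 : ∀ x, 0 ≤ k x := fun x => le_max_left _ _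
    have hkc : ∀ x, k x ≤ c := fun x => max_le hc.le (min_le_right _ _)
    have hint : ∀ ρ : Measure S, IsFiniteMeasure ρ → Integrable k ρ := fun ρ _ =>
      Integrable.of_bound hk.aestronglyMeasurable c (ae_of_all _ fun x => by
        rw [Real.norm_of_nonneg (hk0 x)]; exact hkc x)
    have h1 := integral_sub_integral_le_of_monotone h hk
      (fun x y hxy => max_le_max le_rfl (min_le_min (hmono hxy) le_rfl)) hk0 hkc hc.le
    have h2 : ∫ x, (c - k x) ∂μ ≤ ∫ x in {x | q x < c}, (c - q x) ∂μ := by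
      rw [← integral_indicator hB]
      refine integral_mono ((integrable_const c).sub (hint μ inferInstance))
        (((integrable_const c).sub hμ).indicator hB) fun x => ?_
      by_cases hx : q x < c
      · simp only [indicator, mem_ofPred_eq, hx, if_true, k]
        rw [min_eq_left hx.le]
        linarith [le_max_right 0 (q x)]
      · simp only [indicator, mem_ofPred_eq, hx, if_false, k]
        rw [min_eq_right (not_lt.1 hx), max_eq_right hc.le, sub_self]
    have h3 : ∫ x, k x ∂ν ≤ ∫ x in {x | 0 < q x}, q x ∂ν := by
      rw [← integral_indicator hB']
      refine integral_mono (hint ν inferInstance) (hν.indicator hB') fun x => ?_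
      by_cases hx : 0 < q x
      · simp only [indicator, mem_ofPred_eq, hx, if_true, k]
        exact max_le hx.le (min_le_left _ _)
      · simp only [indicator, mem_ofPred_eq, hx, if_false, k]
        exact max_le le_rfl ((min_le_left _ _).trans (not_lt.1 hx))
    rw [integral_sub (integrable_const c) (hint μ inferInstance), integral_const, smul_eq_mul] at h2
    linarith

/-- If the deficit of dominance on upper sets is at most `μ S - a`, there is an ordered component
pair of mass `a`. -/
theorem exists_orderedComponentPair {μ ν : FiniteMeasure S} {a : ℝ} (ha : 0 ≤ a)
    (h : ∀ I : Set S, MeasurableSet I → IsUpperSet I →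
      (μ : Measure S).real I - (ν : Measure S).real I ≤ (μ : Measure S).real univ - a) :
    ∃ p ∈ orderedComponentPairs μ ν, (p.1.mass : ℝ) = a := by
  let E := (Set S → ℝ) × (Set S → ℝ)
  let fstAt : Set S → E →L[ℝ] ℝ := fun A =>
    (ContinuousLinearMap.proj A).comp (ContinuousLinearMap.fst ℝ _ _)
  let sndAt : Set S → E →L[ℝ] ℝ := fun A =>
    (ContinuousLinearMap.proj A).comp (ContinuousLinearMap.snd ℝ _ _)
  let ι := ℝ × ℝ × {I : Set S // MeasurableSet I ∧ IsUpperSet I}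
  -- For i = (t, s, I) the inequality reads t (m S - a) + s (n S - m S) + (n I - m I) ≥ 0. Real t
  -- and s of both signs encode the mass equalities.
  let L : ι → E →L[ℝ] ℝ := fun i =>
    (i.1 - i.2.1) • fstAt univ - fstAt i.2.2 + i.2.1 • sndAt univ + sndAt i.2.2
  have hL : ∀ i (x : E), L i x =
      (i.1 - i.2.1) * x.1 univ - x.1 i.2.2 + i.2.1 * x.2 univ + x.2 i.2.2 := fun i x => rfl
  obtain ⟨⟨m, n⟩, ⟨hm, hn⟩, hx⟩ := exists_forall_le_of_forall_weights
    ((isCompact_dominatedContents (μ : Measure S)).prod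
      (isCompact_dominatedContents (ν : Measure S)))
    ((convex_dominatedContents (μ : Measure S)).prod (convex_dominatedContents (ν : Measure S)))
    L (fun i => i.1 * a) (by
      intro s w hw
      -- The weighted functional is ∫ (c - q) dm + ∫ q dn, with `q` monotone. It is maximized by
      -- restricting μ to {q < c} and ν to {q > 0}.
      let c : ℝ := ∑ i ∈ s, w i * i.1
      let q : S → ℝ := fun x => ∑ i ∈ s, w i * (i.2.1 + (i.2.2 : Set S).indicator 1 x)
      have hind : ∀ i : ι, Measurable ((i.2.2 : Set S).indicator (1 : S → ℝ)) := fun i =>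
        measurable_one.indicator i.2.2.2.1
      have hq : Measurable q := Finset.measurable_sum _ fun i _ =>
        ((hind i).const_add _).const_mul _
      have hmono : Monotone q := fun x y hxy => Finset.sum_le_sum fun i _ => by
        refine mul_le_mul_of_nonneg_left (add_le_add le_rfl ?_) (hw i)
        by_cases hx : x ∈ (i.2.2 : Set S)
        · simp [hx, i.2.2.2.2 hxy hx]
        · rw [indicator_of_notMem hx]
          exact indicator_nonneg (fun _ _ => zero_le_one) _
      have hiint : ∀ (ρ : Measure S) [IsFiniteMeasure ρ] (i : ι),
          Integrable ((i.2.2 : Set S).indicator (1 : S → ℝ)) ρ := fun ρ _ i =>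
        (integrable_const (1 : ℝ)).indicator i.2.2.2.1
      have htint : ∀ (ρ : Measure S) [IsFiniteMeasure ρ] (i : ι),
          Integrable (fun x => w i * (i.2.1 + (i.2.2 : Set S).indicator (1 : S → ℝ) x)) ρ :=
        fun ρ _ i => ((integrable_const _).add (hiint ρ i)).const_mul _
      have hqint : ∀ (ρ : Measure S) [IsFiniteMeasure ρ], Integrable q ρ := fun ρ _ =>
        integrable_finsetSum _ fun i _ => htint ρ i
      have hqval : ∀ (ρ : Measure S) [IsFiniteMeasure ρ],
          ∫ x, q x ∂ρ = ∑ i ∈ s, w i * (i.2.1 * ρ.real univ + ρ.real i.2.2) := by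
        intro ρ _
        rw [integral_finsetSum _ fun i _ => htint ρ i]
        refine Finset.sum_congr rfl fun i _ => ?_
        rw [integral_const_mul, integral_add (integrable_const _) (hiint ρ i), integral_const,
          integral_indicator_one i.2.2.2.1, smul_eq_mul, mul_comm (ρ.real univ)]
      refine ⟨(((μ : Measure S).restrict {x | q x < c}).real,
        ((ν : Measure S).restrict {x | 0 < q x}).real),
        ⟨restrict_mem_dominatedContents _ _, restrict_mem_dominatedContents _ _⟩, ?_⟩
      have := mul_le_integral_posPart_add ha h hq hmono (hqint _) (hqint _) c
      rw [integral_sub (integrable_const c) (hqint _), hqval, hqval, integral_const,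
        smul_eq_mul] at this
      simp only [c] at this
      rw [Finset.sum_mul, Finset.mul_sum, ← Finset.sum_sub_distrib, ← Finset.sum_add_distrib]
        at this
      refine (Finset.sum_congr rfl fun i _ => ?_).trans_le (this.trans_eq
        (Finset.sum_congr rfl fun i _ => ?_))
      · ring
      · rw [hL]
        ring)
  simp only [hL] at hx
  obtain ⟨μ', hμ', hμm⟩ := exists_measure_of_mem_dominatedContents hm
  obtain ⟨ν', hν', hνn⟩ := exists_measure_of_mem_dominatedContents hn
  have hfin : IsFiniteMeasure μ' := isFiniteMeasure_of_le _ hμ'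
  have hfin' : IsFiniteMeasure ν' := isFiniteMeasure_of_le _ hν'
  have hle : ∀ I : Set S, MeasurableSet I → IsUpperSet I → μ'.real I ≤ ν'.real I := by
    intro I hI hI'
    have := hx ⟨0, 0, I, hI, hI'⟩
    rw [hμm I hI, hνn I hI]
    simp only [zero_mul, sub_zero] at this
    linarith
  have hm0 : m ∅ = 0 := by simpa using (hμm ∅ MeasurableSet.empty).symm
  have hn0 : n ∅ = 0 := by simpa using (hνn ∅ MeasurableSet.empty).symm
  have h1 : a ≤ μ'.real univ := by
    have := hx ⟨1, 0, ∅, MeasurableSet.empty, isUpperSet_empty⟩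
    rw [hμm _ MeasurableSet.univ]
    simp only [hm0, hn0] at this ⊢
    linarith
  have h2 : ν'.real univ ≤ a := by
    have := hx ⟨-1, -1, ∅, MeasurableSet.empty, isUpperSet_empty⟩
    rw [hνn _ MeasurableSet.univ]
    simp only [hm0, hn0] at this ⊢
    linarith
  have h3 := hle univ MeasurableSet.univ isUpperSet_univ
  refine ⟨(⟨μ', hfin⟩, ⟨ν', hfin'⟩), ⟨hμ', hν', ⟨?_, ?_⟩⟩, ?_⟩
  · exact NNReal.coe_injective (show μ'.real univ = ν'.real univ by linarith)
  · intro I hI hI'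
    exact NNReal.coe_le_coe.1 (hle I hI hI')
  · exact show μ'.real univ = a by linarith

end Duality

/-! ### γ as a distance over upper sets -/

section Defect

variable {S : Type*} [MeasurableSpace S] [Preorder S]

/-- The largest violation `sup_I (μ I - ν I)`, over Borel upper sets `I`, of `μ ⪯_sd ν`. -/
def dominanceDefect (μ ν : Measure S) : ℝ :=
  ⨆ I : {I : Set S // MeasurableSet I ∧ IsUpperSet I}, (μ.real I - ν.real I)

theorem sub_le_dominanceDefect (μ ν : Measure S) [IsFiniteMeasure μ] {I : Set S}
    (hI : MeasurableSet I) (hI' : IsUpperSet I) : μ.real I - ν.real I ≤ dominanceDefect μ ν := by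
  refine le_ciSup (f := fun I : {I : Set S // MeasurableSet I ∧ IsUpperSet I} =>
    μ.real I - ν.real I) ⟨μ.real univ, ?_⟩ ⟨I, hI, hI'⟩
  rintro _ ⟨J, rfl⟩
  have h1 : μ.real J ≤ μ.real univ := measureReal_mono (subset_univ _)
  have h2 : 0 ≤ ν.real J := measureReal_nonneg
  exact (sub_le_self _ h2).trans h1

theorem dominanceDefect_le {μ ν : Measure S} {c : ℝ}
    (h : ∀ I : Set S, MeasurableSet I → IsUpperSet I → μ.real I - ν.real I ≤ c) :
    dominanceDefect μ ν ≤ c := by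
  have : Nonempty {I : Set S // MeasurableSet I ∧ IsUpperSet I} :=
    ⟨⟨∅, MeasurableSet.empty, isUpperSet_empty⟩⟩
  exact ciSup_le fun I => h I I.2.1 I.2.2

theorem dominanceDefect_nonneg (μ ν : Measure S) [IsFiniteMeasure μ] : 0 ≤ dominanceDefect μ ν := by
  simpa using sub_le_dominanceDefect μ ν MeasurableSet.empty isUpperSet_empty

theorem dominanceDefect_self (μ : Measure S) [IsFiniteMeasure μ] : dominanceDefect μ μ = 0 :=
  le_antisymm (dominanceDefect_le fun _ _ _ => (sub_self _).le) (dominanceDefect_nonneg μ μ)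

theorem dominanceDefect_triangle (μ ν ρ : Measure S) [IsFiniteMeasure μ] [IsFiniteMeasure ν] :
    dominanceDefect μ ρ ≤ dominanceDefect μ ν + dominanceDefect ν ρ :=
  dominanceDefect_le fun I hI hI' => by
    have h1 := sub_le_dominanceDefect μ ν hI hI'
    have h2 := sub_le_dominanceDefect ν ρ hI hI'
    linarith

/-- Strassen-type duality for the ordered affinity. -/
theorem orderedAffinity_eq (μ ν : ProbabilityMeasure S) :
    orderedAffinity μ.toFiniteMeasure ν.toFiniteMeasure
      = 1 - dominanceDefect (μ : Measure S) (ν : Measure S) := by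
  refine le_antisymm (csSup_le (masses_nonempty _ _) ?_) ?_
  · rintro _ ⟨p, ⟨hp1, hp2, hp⟩, rfl⟩
    rw [le_sub_comm]
    refine dominanceDefect_le fun I hI hI' => ?_
    have h1 : (p.1 : Measure S).real I ≤ (p.2 : Measure S).real I :=
      NNReal.coe_le_coe.2 (hp.le_of_increasing I hI hI')
    have h2 : (p.2 : Measure S).real I ≤ (ν : Measure S).real I :=
      ENNReal.toReal_mono (measure_ne_top _ _) (hp2 I)
    -- Passing to the complement uses μ' ≤ μ off I: μ I ≤ 1 - μ' Iᶜ = 1 - μ' S + μ' I.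
    have h3 : (p.1 : Measure S).real Iᶜ ≤ (μ : Measure S).real Iᶜ :=
      ENNReal.toReal_mono (measure_ne_top _ _) (hp1 Iᶜ)
    rw [measureReal_compl hI, measureReal_compl hI, probReal_univ (μ := (μ : Measure S))] at h3
    have h4 : (p.1.mass : ℝ) = (p.1 : Measure S).real univ := rfl
    simp only [h4]
    linarith
  · have hle : dominanceDefect (μ : Measure S) (ν : Measure S) ≤ 1 :=
      dominanceDefect_le fun I _ _ => (sub_le_self _ measureReal_nonneg).trans measureReal_le_one
    obtain ⟨p, hp, hpa⟩ := exists_orderedComponentPair (μ := μ.toFiniteMeasure)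
      (ν := ν.toFiniteMeasure) (sub_nonneg.2 hle) fun I hI hI' => by
        have h1 := sub_le_dominanceDefect (μ : Measure S) (ν : Measure S) hI hI'
        have h2 : ((μ.toFiniteMeasure : FiniteMeasure S) : Measure S).real univ = 1 :=
          probReal_univ (μ := (μ : Measure S))
        rw [h2, sub_sub_cancel]
        exact h1
    exact le_csSup (masses_bddAbove _ _) ⟨p, hp, hpa⟩

theorem gamma_eq (μ ν : ProbabilityMeasure S) :
    gamma μ ν = dominanceDefect (μ : Measure S) (ν : Measure S)
      + dominanceDefect (ν : Measure S) (μ : Measure S) := by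
  rw [gamma, orderedAffinity_eq, orderedAffinity_eq]
  ring

theorem gamma_self (μ : ProbabilityMeasure S) : gamma μ μ = 0 := by
  rw [gamma_eq, dominanceDefect_self, add_zero]

theorem gamma_comm (μ ν : ProbabilityMeasure S) : gamma μ ν = gamma ν μ := by
  rw [gamma_eq, gamma_eq, add_comm]

theorem gamma_triangle (μ ν ρ : ProbabilityMeasure S) :
    gamma μ ρ ≤ gamma μ ν + gamma ν ρ := by
  simp only [gamma_eq]
  have h1 := dominanceDefect_triangle (μ : Measure S) (ν : Measure S) (ρ : Measure S)
  have h2 := dominanceDefect_triangle (ρ : Measure S) (ν : Measure S) (μ : Measure S)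
  linarith

theorem abs_sub_le_gamma (μ ν : ProbabilityMeasure S) {I : Set S} (hI : MeasurableSet I)
    (hI' : IsUpperSet I) : |(μ : Measure S).real I - (ν : Measure S).real I| ≤ gamma μ ν := by
  rw [gamma_eq]
  have h1 := sub_le_dominanceDefect (μ : Measure S) (ν : Measure S) hI hI'
  have h2 := sub_le_dominanceDefect (ν : Measure S) (μ : Measure S) hI hI'
  have h3 := dominanceDefect_nonneg (μ : Measure S) (ν : Measure S)
  have h4 := dominanceDefect_nonneg (ν : Measure S) (μ : Measure S)
  rw [abs_le]
  constructor <;> linarith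

theorem abs_sub_le_gamma_of_isLowerSet (μ ν : ProbabilityMeasure S) {D : Set S}
    (hD : MeasurableSet D) (hD' : IsLowerSet D) :
    |(μ : Measure S).real D - (ν : Measure S).real D| ≤ gamma μ ν := by
  have h := abs_sub_le_gamma μ ν hD.compl hD'.compl
  rw [probReal_compl_eq_one_sub hD, probReal_compl_eq_one_sub hD, sub_sub_sub_cancel_left,
    abs_sub_comm] at h
  exact h

theorem gamma_le {μ ν : ProbabilityMeasure S} {c : ℝ}
    (h : ∀ I : Set S, MeasurableSet I → IsUpperSet I →
      |(μ : Measure S).real I - (ν : Measure S).real I| ≤ c) : gamma μ ν ≤ c + c := by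
  rw [gamma_eq]
  refine add_le_add (dominanceDefect_le fun I hI hI' => ?_)
    (dominanceDefect_le fun I hI hI' => ?_)
  · exact (le_abs_self _).trans (h I hI hI')
  · rw [← neg_sub]
    exact (neg_le_abs _).trans (h I hI hI')

end Defect

/-! ### Upper sets determine the measure -/

section Separation

variable {S : Type*} [TopologicalSpace S] [PolishSpace S] [MeasurableSpace S] [BorelSpace S]
  [PartialOrder S] [OrderClosedTopology S]

/-- A projection of a Borel subset of the closed order graph. Analyticity is what Lusin separation
requires. -/
theorem analyticSet_upperClosure {C : Set S} (hC : MeasurableSet C) :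
    AnalyticSet (upperClosure C : Set S) := by
  have h : (upperClosure C : Set S) = Prod.snd '' ({p : S × S | p.1 ≤ p.2} ∩ Prod.fst ⁻¹' C) := by
    ext y
    simp only [SetLike.mem_coe, mem_upperClosure, mem_image, mem_inter_iff, mem_ofPred_eq,
      mem_preimage, Prod.exists, exists_eq_right]
    exact exists_congr fun x => and_comm
  rw [h]
  exact ((isClosed_le continuous_fst continuous_snd).measurableSet.inter
    (measurable_fst hC)).analyticSet_image measurable_snd

theorem analyticSet_lowerClosure {C : Set S} (hC : MeasurableSet C) :
    AnalyticSet (lowerClosure C : Set S) := by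
  have h : (lowerClosure C : Set S) = Prod.fst '' ({p : S × S | p.1 ≤ p.2} ∩ Prod.snd ⁻¹' C) := by
    ext y
    simp only [SetLike.mem_coe, mem_lowerClosure, mem_image, mem_inter_iff, mem_ofPred_eq,
      mem_preimage, Prod.exists, exists_and_right, exists_eq_right]
    exact exists_congr fun x => and_comm
  rw [h]
  exact ((isClosed_le continuous_fst continuous_snd).measurableSet.inter
    (measurable_snd hC)).analyticSet_image measurable_fst

/-- Ordered version of the Lusin separation theorem. -/
theorem exists_measurableSet_isUpperSet_separating {A B : Set S} (hA : MeasurableSet A)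
    (hB : MeasurableSet B) (h : ∀ a ∈ A, ∀ b ∈ B, ¬ a ≤ b) :
    ∃ I : Set S, MeasurableSet I ∧ IsUpperSet I ∧ A ⊆ I ∧ Disjoint I B := by
  let P : Set S → Prop := fun C => MeasurableSet C ∧ Disjoint C (lowerClosure B : Set S)
  have step : ∀ C : {C // P C}, ∃ C' : {C // P C}, (upperClosure (C : Set S) : Set S) ⊆ C' := by
    rintro ⟨C, hC, hCB⟩
    have hd : Disjoint (upperClosure C : Set S) (lowerClosure B : Set S) := by
      rw [Set.disjoint_left] at hCB ⊢
      rintro z ⟨x, hx, hxz⟩ hz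
      exact hCB hx ((lowerClosure B).lower hxz hz)
    obtain ⟨C', h1, h2, h3⟩ :=
      (analyticSet_upperClosure hC).measurablySeparable (analyticSet_lowerClosure hB) hd
    exact ⟨⟨C', h3, h2.symm⟩, h1⟩
  choose F hF using step
  have hA0 : P A := ⟨hA, by
    rw [Set.disjoint_left]
    rintro a ha ⟨b, hb, hab⟩
    exact h a ha b hb hab⟩
  -- Each iterate is a Borel set containing the upper closure of the previous one and still missing
  -- the lower closure of `B`. The union is therefore Borel and an upper set.
  let C : ℕ → {C // P C} := fun n => F^[n] ⟨A, hA0⟩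
  have hC : ∀ n, (upperClosure (C n : Set S) : Set S) ⊆ C (n + 1) := fun n => by
    simp only [C, Function.iterate_succ_apply']
    exact hF _
  refine ⟨⋃ n, (C n : Set S), MeasurableSet.iUnion fun n => (C n).2.1, ?_,
    subset_iUnion (fun n => (C n : Set S)) 0, ?_⟩
  · intro x y hxy hx
    obtain ⟨n, hn⟩ := mem_iUnion.1 hx
    exact mem_iUnion.2 ⟨n + 1, hC n ⟨x, hn, hxy⟩⟩
  · rw [Set.disjoint_iUnion_left]
    exact fun n => (C n).2.2.mono_right subset_lowerClosure

variable (S) in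
/-- Countably many Borel upper sets separate the points. -/
theorem exists_countable_isUpperSet_separating :
    ∃ 𝒮 : Set (Set S), 𝒮.Countable ∧ (∀ I ∈ 𝒮, MeasurableSet I ∧ IsUpperSet I) ∧
      ∀ x y : S, (∀ I ∈ 𝒮, x ∈ I ↔ y ∈ I) → x = y := by
  let ℬ := TopologicalSpace.countableBasis S
  have hℬ := TopologicalSpace.isBasis_countableBasis S
  let J : Set (Set S × Set S) := {p | p ∈ ℬ ×ˢ ℬ ∧ ∀ a ∈ p.1, ∀ b ∈ p.2, ¬ a ≤ b}
  have hJ : J.Countable := ((TopologicalSpace.countable_countableBasis S).prod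
    (TopologicalSpace.countable_countableBasis S)).mono fun p hp => hp.1
  have hsep : ∀ p : J, ∃ I : Set S, MeasurableSet I ∧ IsUpperSet I ∧ p.1.1 ⊆ I ∧
      Disjoint I p.1.2 := fun p =>
    exists_measurableSet_isUpperSet_separating (hℬ.isOpen p.2.1.1).measurableSet
      (hℬ.isOpen p.2.1.2).measurableSet p.2.2
  choose I hI using hsep
  have : Countable J := hJ.to_subtype
  have key : ∀ x y : S, (∀ T ∈ range I, x ∈ T ↔ y ∈ T) → x ≤ y := by
    intro x y h
    by_contra hxy
    have hopen : IsOpen {p : S × S | p.1 ≤ p.2}ᶜ :=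
      (isClosed_le continuous_fst continuous_snd).isOpen_compl
    -- Closedness of the order surrounds a pair with x ≰ y by an open box of such pairs, which is
    -- then shrunk to basic sets.
    obtain ⟨U, V, hU, hV, hxU, hyV, hUV⟩ := isOpen_prod_iff.1 hopen x y hxy
    obtain ⟨U', hU', hxU', hUU'⟩ := hℬ.exists_subset_of_mem_open hxU hU
    obtain ⟨V', hV', hyV', hVV'⟩ := hℬ.exists_subset_of_mem_open hyV hV
    let p : J := ⟨(U', V'), ⟨hU', hV'⟩, fun a ha b hb =>
      hUV (mk_mem_prod (hUU' ha) (hVV' hb))⟩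
    obtain ⟨-, -, h1, h2⟩ := hI p
    exact Set.disjoint_left.1 h2 ((h _ ⟨p, rfl⟩).1 (h1 hxU')) hyV'
  refine ⟨range I, countable_range I, ?_, fun x y h => le_antisymm (key x y h)
    (key y x fun T hT => (h T hT).symm)⟩
  rintro _ ⟨p, rfl⟩
  exact ⟨(hI p).1, (hI p).2.1⟩

/-- Finite measures on an ordered Polish space are determined by the Borel upper sets. -/
theorem ext_of_isUpperSet {μ ν : Measure S} [IsFiniteMeasure μ] [IsFiniteMeasure ν]
    (h : ∀ I : Set S, MeasurableSet I → IsUpperSet I → μ.real I = ν.real I) : μ = ν := by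
  let 𝒞 : Set (Set S) := {A | ∃ U D : Set S, MeasurableSet U ∧ IsUpperSet U ∧ MeasurableSet D ∧
    IsLowerSet D ∧ A = U ∩ D}
  obtain ⟨𝒮, h𝒮c, h𝒮, h𝒮s⟩ := exists_countable_isUpperSet_separating S
  have hgen : ‹MeasurableSpace S› = MeasurableSpace.generateFrom 𝒞 := by
    have hle : MeasurableSpace.generateFrom 𝒞 ≤ ‹MeasurableSpace S› := by
      refine MeasurableSpace.generateFrom_le ?_
      rintro _ ⟨U, D, hU, -, hD, -, rfl⟩
      exact hU.inter hD
    refine le_antisymm (fun A hA => ?_) hle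
    have hcs : @MeasurableSpace.CountablySeparated S (MeasurableSpace.generateFrom 𝒞) :=
      @MeasurableSpace.CountablySeparated.mk S (MeasurableSpace.generateFrom 𝒞)
        ⟨𝒮, h𝒮c, fun I hI => MeasurableSpace.measurableSet_generateFrom
          ⟨I, univ, (h𝒮 I hI).1, (h𝒮 I hI).2, MeasurableSet.univ, isLowerSet_univ,
            (inter_univ I).symm⟩, fun x _ y _ hxy => h𝒮s x y hxy⟩
    -- Lusin-Souslin: an injective measurable map from a standard Borel space to a countably
    -- separated one sends Borel sets to measurable sets. Applied to the identity, it makes the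
    -- smaller σ-algebra all of the Borel sets.
    have hemb := @Measurable.measurableEmbedding S S (MeasurableSpace.generateFrom 𝒞) id hcs _ _
      (measurable_id'' hle) Function.injective_id
    have := @MeasurableEmbedding.measurableSet_image' S S _ (MeasurableSpace.generateFrom 𝒞) id
      hemb A hA
    rwa [image_id] at this
  refine ext_of_generate_finite 𝒞 hgen ?_ ?_ ?_
  · rintro _ ⟨U, D, hU, hU', hD, hD', rfl⟩ _ ⟨V, E, hV, hV', hE, hE', rfl⟩ -
    exact ⟨U ∩ V, D ∩ E, hU.inter hV, hU'.inter hV', hD.inter hE, hD'.inter hE',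
      inter_inter_inter_comm U D V E⟩
  · rintro _ ⟨U, D, hU, hU', hD, hD', rfl⟩
    -- Both U and U \ D are upper sets, and their difference in measure is the measure of U ∩ D.
    have h1 := h U hU hU'
    have h2 := h (U \ D) (hU.diff hD) (hU'.inter hD'.compl)
    rw [← measureReal_inter_add_sdiff (μ := μ) hD, ← measureReal_inter_add_sdiff (μ := ν) hD] at h1
    rw [← measureReal_eq_measureReal_iff]
    linarith
  · rw [← measureReal_eq_measureReal_iff (μ := μ) (ν := ν)]
    exact h univ MeasurableSet.univ isUpperSet_univ

theorem eq_of_gamma_eq_zero {μ ν : ProbabilityMeasure S} (h : gamma μ ν = 0) : μ = ν := by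
  refine Subtype.ext (ext_of_isUpperSet (μ := (μ : Measure S)) (ν := (ν : Measure S))
    fun I hI hI' => ?_)
  have := abs_sub_le_gamma μ ν hI hI'
  rw [h] at this
  exact sub_eq_zero.1 (abs_nonpos_iff.1 this)

end Separation

/-! ### Weak limits and inner approximation -/

section WeakLimits

variable {S : Type*} [TopologicalSpace S] [PolishSpace S] [MeasurableSpace S] [BorelSpace S]

theorem exists_isCompact_sdiff_real_lt (μ : ProbabilityMeasure S) {A : Set S}
    (hA : MeasurableSet A) {e : ℝ} (he : 0 < e) :
    ∃ K ⊆ A, IsCompact K ∧ (μ : Measure S).real A - (μ : Measure S).real K < e := by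
  obtain ⟨K, hKA, hK, hlt⟩ := hA.exists_isCompact_sdiff_lt (measure_ne_top (μ : Measure S) A)
    (ENNReal.ofReal_pos.2 he).ne'
  refine ⟨K, hKA, hK, ?_⟩
  rw [← measureReal_sdiff hKA hK.isClosed.measurableSet]
  exact (ENNReal.lt_ofReal_iff_toReal_lt (measure_ne_top _ _)).1 hlt

/-- A sequence of measures that is uniformly Cauchy on `A` and on a closed approximation of `A`
from inside is asymptotically bounded on `A` by any weak subsequential limit. -/
theorem real_le_of_tendsto_subseq {u : ℕ → ProbabilityMeasure S} {μ : ProbabilityMeasure S}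
    {φ : ℕ → ℕ} (hφ : StrictMono φ) (hμ : Tendsto (u ∘ φ) atTop (𝓝 μ)) {e : ℝ} (he : 0 < e)
    {N : ℕ} {A C : Set S} (hC : IsClosed C) (hCA : C ⊆ A)
    (hNA : ∀ n ≥ N, |(u n : Measure S).real A - (u N : Measure S).real A| < e)
    (hNC : ∀ n ≥ N, |(u n : Measure S).real C - (u N : Measure S).real C| < e)
    (hAC : (u N : Measure S).real A - (u N : Measure S).real C < e) {n : ℕ} (hn : N ≤ n) :
    (u n : Measure S).real A ≤ (μ : Measure S).real A + 4 * e := by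
  -- The four errors: u n A to u N A, to u N C, to u (φ k) C, and to μ C by portmanteau.
  have hlim := ProbabilityMeasure.limsup_measure_closed_le_of_tendsto hμ hC
  have hlt : (μ : Measure S) C < (μ : Measure S) C + ENNReal.ofReal e :=
    ENNReal.lt_add_right (measure_ne_top _ _) (ENNReal.ofReal_pos.2 he).ne'
  obtain ⟨k, hk, hkN⟩ := ((eventually_lt_of_limsup_lt (hlim.trans_lt hlt)).and
    (eventually_ge_atTop N)).exists
  have h1 : (u (φ k) : Measure S).real C ≤ (μ : Measure S).real C + e := by
    have := ENNReal.toReal_mono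
      (ENNReal.add_ne_top.2 ⟨measure_ne_top _ _, ENNReal.ofReal_ne_top⟩) hk.le
    rwa [ENNReal.toReal_add (measure_ne_top _ _) ENNReal.ofReal_ne_top,
      ENNReal.toReal_ofReal he.le] at this
  have h2 : (μ : Measure S).real C ≤ (μ : Measure S).real A := measureReal_mono hCA
  have h3 := (abs_lt.1 (hNA n hn)).2
  have h4 := (abs_lt.1 (hNC (φ k) (hkN.trans (hφ.id_le k)))).1
  linarith

end WeakLimits

/-! ### Tightness and completeness -/

section Completeness

variable {S : Type*} [TopologicalSpace S] [PartialOrder S] [OrderClosedTopology S]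

/-- Projection along a compact factor is a closed map. This lets a compact set inside an upper set
be enlarged to a closed upper set inside it. -/
theorem isClosed_upperClosure_of_isCompact {K : Set S} (hK : IsCompact K) :
    IsClosed (upperClosure K : Set S) := by
  have h : (upperClosure K : Set S) = Prod.snd '' {p : K × S | (p.1 : S) ≤ p.2} := by
    ext y
    simp
  have : CompactSpace K := isCompact_iff_compactSpace.1 hK
  rw [h]
  exact isClosedMap_snd_of_compactSpace _
    (isClosed_le (continuous_subtype_val.comp continuous_fst) continuous_snd)

theorem isClosed_lowerClosure_of_isCompact {K : Set S} (hK : IsCompact K) :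
    IsClosed (lowerClosure K : Set S) := by
  have h : (lowerClosure K : Set S) = Prod.snd '' {p : K × S | p.2 ≤ (p.1 : S)} := by
    ext y
    simp
  have : CompactSpace K := isCompact_iff_compactSpace.1 hK
  rw [h]
  exact isClosedMap_snd_of_compactSpace _
    (isClosed_le continuous_snd (continuous_subtype_val.comp continuous_fst))

variable [PolishSpace S] [MeasurableSpace S] [BorelSpace S]

/-- Under the compactness hypothesis on order-convex hulls, `γ`-Cauchy sequences are tight. -/
theorem isTightMeasureSet_range_of_gamma_cauchy
    (hS : ∀ K : Set S, IsCompact K →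
      IsCompact ((upperClosure K : Set S) ∩ (lowerClosure K : Set S)))
    {u : ℕ → ProbabilityMeasure S}
    (hu : ∀ e > 0, ∃ N, ∀ n ≥ N, gamma (u n) (u N) < e) :
    IsTightMeasureSet {((μ : ProbabilityMeasure S) : Measure S) | μ ∈ range u} := by
  rw [isTightMeasureSet_iff_exists_isCompact_measure_compl_le]
  intro ε hε
  obtain ⟨e, he, heε⟩ : ∃ e : ℝ, 0 < e ∧ ENNReal.ofReal (4 * e) ≤ ε := by
    rcases eq_or_ne ε ⊤ with rfl | htop
    · exact ⟨1, one_pos, le_top⟩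
    · refine ⟨ε.toReal / 4, div_pos (ENNReal.toReal_pos hε.ne' htop) (by norm_num), ?_⟩
      rw [mul_div_cancel₀ _ (by norm_num), ENNReal.ofReal_toReal htop]
  obtain ⟨N, hN⟩ := hu e he
  have hcpt : ∀ i, ∃ K : Set S, IsCompact K ∧ 1 - (u i : Measure S).real K < e := fun i => by
    obtain ⟨K, -, hK, hlt⟩ := exists_isCompact_sdiff_real_lt (u i) MeasurableSet.univ he
    rw [probReal_univ (μ := (u i : Measure S))] at hlt
    exact ⟨K, hK, hlt⟩
  choose K hK hKe using hcpt
  -- One compact set serves all u i with i ≤ N. For later indices γ transfers the mass of i(Q) and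
  -- d(Q) from u N at cost `e`, so each complement has mass below 2e.
  let Q : Set S := ⋃ i ∈ Finset.range (N + 1), K i
  have hQ : IsCompact Q := (Finset.range (N + 1)).isCompact_biUnion fun i _ => hK i
  have hQe : ∀ i ≤ N, 1 - (u i : Measure S).real Q < e := fun i hi => by
    have : (u i : Measure S).real (K i) ≤ (u i : Measure S).real Q :=
      measureReal_mono (fun x hx => mem_iUnion₂.2
        ⟨i, Finset.mem_range.2 (Nat.lt_succ_of_le hi), hx⟩) (measure_ne_top _ _)
    linarith [hKe i]
  have hup : MeasurableSet (upperClosure Q : Set S) :=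
    (isClosed_upperClosure_of_isCompact hQ).measurableSet
  have hlo : MeasurableSet (lowerClosure Q : Set S) :=
    (isClosed_lowerClosure_of_isCompact hQ).measurableSet
  refine ⟨_, hS Q hQ, ?_⟩
  rintro _ ⟨_, ⟨n, rfl⟩, rfl⟩
  refine le_trans ?_ heε
  rw [← ENNReal.ofReal_toReal (measure_ne_top (u n : Measure S) _)]
  refine ENNReal.ofReal_le_ofReal ?_
  change (u n : Measure S).real _ ≤ 4 * e
  have hge : ∀ i ≤ N, 1 - e < (u i : Measure S).real (upperClosure Q : Set S) ∧
      1 - e < (u i : Measure S).real (lowerClosure Q : Set S) := fun i hi => by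
    have h1 : (u i : Measure S).real Q ≤ (u i : Measure S).real (upperClosure Q : Set S) :=
      measureReal_mono subset_upperClosure
    have h2 : (u i : Measure S).real Q ≤ (u i : Measure S).real (lowerClosure Q : Set S) :=
      measureReal_mono subset_lowerClosure
    constructor <;> linarith [hQe i hi]
  have hge' : 1 - 2 * e < (u n : Measure S).real (upperClosure Q : Set S) ∧
      1 - 2 * e < (u n : Measure S).real (lowerClosure Q : Set S) := by
    rcases le_total n N with hn | hn
    · exact ⟨by linarith [(hge n hn).1], by linarith [(hge n hn).2]⟩
    · have h1 := abs_sub_le_gamma (u n) (u N) hup (upperClosure Q).upper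
      have h2 := abs_sub_le_gamma_of_isLowerSet (u n) (u N) hlo (lowerClosure Q).lower
      have h3 := hN n hn
      have h4 := hge N le_rfl
      exact ⟨by linarith [(abs_le.1 h1).1, h4.1], by linarith [(abs_le.1 h2).1, h4.2]⟩
  rw [compl_inter]
  refine (measureReal_union_le _ _).trans ?_
  rw [probReal_compl_eq_one_sub hup, probReal_compl_eq_one_sub hlo]
  linarith [hge'.1, hge'.2]

/-- For an upper set I, approximate I from inside by i(K) with K compact, and Iᶜ by d(K). These
approximants are closed and γ-controlled, so the portmanteau bound gives both inequalities. K
depends on I but N does not, so the estimate is uniform in I. -/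
theorem exists_tendsto_gamma
    (hS : ∀ K : Set S, IsCompact K →
      IsCompact ((upperClosure K : Set S) ∩ (lowerClosure K : Set S)))
    {u : ℕ → ProbabilityMeasure S}
    (hu : ∀ e > 0, ∃ N, ∀ n ≥ N, gamma (u n) (u N) < e) :
    ∃ μ : ProbabilityMeasure S, ∀ e > 0, ∃ N, ∀ n ≥ N, gamma (u n) μ < e := by
  have hcpt := isCompact_closure_of_isTightMeasureSet
    (isTightMeasureSet_range_of_gamma_cauchy hS hu)
  obtain ⟨μ, -, φ, hφ, hμ⟩ := hcpt.tendsto_subseq fun n =>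
    subset_closure (mem_range_self (f := u) n)
  refine ⟨μ, fun ε hε => ?_⟩
  -- The bound 4e on each upper set doubles because γ adds two one-sided defects.
  obtain ⟨e, he, heε⟩ : ∃ e : ℝ, 0 < e ∧ 4 * e + 4 * e < ε := ⟨ε / 9, by positivity, by linarith⟩
  obtain ⟨N, hN⟩ := hu e he
  refine ⟨N, fun n hn => lt_of_le_of_lt (gamma_le fun I hI hI' => ?_) heε⟩
  have hupper : (u n : Measure S).real I ≤ (μ : Measure S).real I + 4 * e := by
    obtain ⟨K, hKI, hK, hlt⟩ := exists_isCompact_sdiff_real_lt (u N) hI he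
    have hC := isClosed_upperClosure_of_isCompact hK
    have hmono : (u N : Measure S).real K ≤ (u N : Measure S).real (upperClosure K : Set S) :=
      measureReal_mono subset_upperClosure
    exact real_le_of_tendsto_subseq hφ hμ he hC (upperClosure_min hKI hI')
      (fun k hk => (abs_sub_le_gamma _ _ hI hI').trans_lt (hN k hk))
      (fun k hk => (abs_sub_le_gamma _ _ hC.measurableSet (upperClosure K).upper).trans_lt (hN k hk))
      (by linarith) hn
  have hlower : (u n : Measure S).real Iᶜ ≤ (μ : Measure S).real Iᶜ + 4 * e := by
    obtain ⟨K, hKI, hK, hlt⟩ := exists_isCompact_sdiff_real_lt (u N) hI.compl he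
    have hC := isClosed_lowerClosure_of_isCompact hK
    have hmono : (u N : Measure S).real K ≤ (u N : Measure S).real (lowerClosure K : Set S) :=
      measureReal_mono subset_lowerClosure
    exact real_le_of_tendsto_subseq hφ hμ he hC (lowerClosure_min hKI hI'.compl)
      (fun k hk => (abs_sub_le_gamma_of_isLowerSet _ _ hI.compl hI'.compl).trans_lt (hN k hk))
      (fun k hk => (abs_sub_le_gamma_of_isLowerSet _ _ hC.measurableSet
        (lowerClosure K).lower).trans_lt (hN k hk))
      (by linarith) hn
  rw [probReal_compl_eq_one_sub hI, probReal_compl_eq_one_sub hI] at hlower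
  rw [abs_le]
  constructor <;> linarith

variable (S) in
/-- The total ordered variation metric on probability measures. -/
@[reducible]
def gammaMetricSpace : MetricSpace (ProbabilityMeasure S) where
  dist := gamma
  dist_self := gamma_self
  dist_comm := gamma_comm
  dist_triangle := gamma_triangle
  eq_of_dist_eq_zero := eq_of_gamma_eq_zero

end Completeness

end TotalOrderedVariation

end

theorem theoremt {S : Type*} [TopologicalSpace S] [PolishSpace S] [MeasurableSpace S]
    [BorelSpace S] [PartialOrder S] [OrderClosedTopology S]
    (hK : ∀ K : Set S, IsCompact K →
      IsCompact ((upperClosure K : Set S) ∩ (lowerClosure K : Set S))) :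
    ∃ m : MetricSpace (ProbabilityMeasure S),
      (∀ μ ν : ProbabilityMeasure S, m.dist μ ν = TotalOrderedVariation.gamma μ ν) ∧
      @CompleteSpace (ProbabilityMeasure S) m.toUniformSpace := by
  refine ⟨TotalOrderedVariation.gammaMetricSpace S, fun _ _ => rfl, ?_⟩
  let := TotalOrderedVariation.gammaMetricSpace S
  refine UniformSpace.complete_of_cauchySeq_tendsto fun u hu => ?_
  obtain ⟨μ, hμ⟩ := TotalOrderedVariation.exists_tendsto_gamma hK (Metric.cauchySeq_iff'.1 hu)
  exact ⟨μ, Metric.tendsto_atTop.2 hμ⟩
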